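/- Let $G$ be a group. A cellular automaton on $G$ is a triple $\mathcal A=\langle S,\mathcal N,f\rangle$ where $S$ is a finite set with at least two elements, $\mathcal N\subseteq G$ is finite, and $f:S^{\mathcal N}\to S$. Its global transition function $F_{\mathcal A}:S^G\to S^G$ is $F_{\mathcal A}(c)(g)=f\big((c(gn))_{n\in\mathcal N}\big)$, and $\mathcal A$ is called injective or surjective if $F_{\mathcal A}$ is. The group $G$ is surjunctive if every injective cellular automaton on $G$ is surjective. The cellular automaton $\mathcal A$ is balanced if for all finite $E,M\subseteq G$ with $E\mathcal N\subseteq M$ every $p:E\to S$ has exactly $|S|^{|M|-|E|}$ pre-images on $M$, that is, functions $q:M\to S$ with $p(g)=f\big((q(gn))_{n\in\mathcal N}\big)$ for all $g\in E$. A finitely generated group $G$ is sofic if, for some finite symmetric set $B$ of generators of $G$ (equivalently, for every such $B$), the following holds: for every integer $r\ge 0$ and real $\varepsilon>0$ there are a finite directed graph $(V,E)$ with edges labeled by $B$, $E\subseteq V\times B\times V$, and a subset $U\subseteq V$ with $|U|>(1-\varepsilon)|V|$, such that for every $u\in U$ the subgraph induced on the set of vertices reached from $u$ by a path of length at most $r$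 is isomorphic, as a labeled graph and by an isomorphism that sends $u$ to $1_G$, to the subgraph of the Cayley graph of $G$ (whose edges are $(g,x,gx)$ with $g\in G$, $x\in B$) induced on the disk of radius $r$ centered at $1_G$. Then: 1. every injective cellular automaton on a surjunctive group is balanced; 2. every injective cellular automaton on a sofic group is balanced. -/

import Mathlib

/-- A cellular automaton on the group `G` with set of states `S` (finite, with at least two
elements): a finite neighborhood and a local update rule. -/
structure CellularAutomaton (G S : Type*) where
  /-- The neighborhood. -/
  nbhd : Finset G
  /-- The local update rule, sending every pattern on the neighborhood to a state. -/
  rule : (nbhd → S) → S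

namespace CellularAutomaton

variable {G S : Type*} [Group G]

/-- The translation of configurations by `g`. -/
def translate (g : G) (c : G → S) : G → S := fun x => c (g * x)

/-- The global transition function `F` of a cellular automaton. -/
def globalMap (A : CellularAutomaton G S) (c : G → S) : G → S :=
  fun g => A.rule (fun n : A.nbhd => translate g c n)

/-- The pattern `q` on `M` is a pre-image of the pattern `p` on `E`: the support `M` contains
`E` times the neighborhood, and the local rule applied to `q` at every point `g` of `E`
gives `p g`. -/
def IsPreimage (A : CellularAutomaton G S) {E M : Finset G} (p : E → S) (q : M → S) : Prop :=
  ∃ h : ∀ g ∈ E, ∀ n ∈ A.nbhd, g * n ∈ M,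
    ∀ g : E, p g = A.rule (fun n : A.nbhd => q ⟨(g : G) * n, h g g.2 n n.2⟩)

/-- Balancedness: if `E` times the neighborhood is contained in `M` (both finite), then every
pattern on `E` has exactly `|S| ^ (|M| - |E|)` pre-images on `M`. The exponent is an integer,
so the power is taken in the rational numbers. -/
def IsBalanced (A : CellularAutomaton G S) : Prop :=
  ∀ E M : Finset G, (∀ g ∈ E, ∀ n ∈ A.nbhd, g * n ∈ M) → ∀ p : E → S,
    (Nat.card {q : M → S // A.IsPreimage p q} : ℚ) =
      (Nat.card S : ℚ) ^ ((M.card : ℤ) - (E.card : ℤ))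

end CellularAutomaton

/-- A group is surjunctive if, for every finite set of states, every injective cellular automaton
on the full shift is surjective. -/
def IsSurjunctive (G : Type*) [Group G] : Prop :=
  ∀ (S : Type) [Finite S] [Nontrivial S] (A : CellularAutomaton G S),
    Function.Injective A.globalMap → Function.Surjective A.globalMap

/-- An `L`-labeled (directed) graph on the vertex set `V`. -/
structure LabeledGraph (V L : Type*) where
  /-- The set of labeled edges. -/
  edges : Set (V × L × V)

namespace LabeledGraph

variable {V W L : Type*}

/-- The set of the vertices that are reached from `u` by a path of length at most `r`. -/
def ball (Γ : LabeledGraph V L) (u : V) : ℕ → Set V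
  | 0 => {u}
  | r + 1 => Γ.ball u r ∪ {w | ∃ v ∈ Γ.ball u r, ∃ l : L, (v, l, w) ∈ Γ.edges}

/-- The subgraph induced on a set of vertices. -/
def induce (Γ : LabeledGraph V L) (s : Set V) : LabeledGraph s L where
  edges := {e | ((e.1 : V), e.2.1, (e.2.2 : V)) ∈ Γ.edges}

/-- A bijection of the vertices is a labeled graph isomorphism. -/
def IsIso (Γ : LabeledGraph V L) (Δ : LabeledGraph W L) (φ : V ≃ W) : Prop :=
  ∀ (x y : V) (l : L), (x, l, y) ∈ Γ.edges ↔ (φ x, l, φ y) ∈ Δ.edges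

/-- The neighborhoods of radius `r` of `u` in `Γ` and of `w` in `Δ` are isomorphic as labeled
graphs, by an isomorphism that matches the centers. -/
def BallIso (Γ : LabeledGraph V L) (u : V) (Δ : LabeledGraph W L) (w : W) (r : ℕ) : Prop :=
  ∃ φ : Γ.ball u r ≃ Δ.ball w r,
    IsIso (Γ.induce (Γ.ball u r)) (Δ.induce (Δ.ball w r)) φ ∧
      ∀ x : Γ.ball u r, (x : V) = u → (φ x : W) = w

end LabeledGraph

/-- The Cayley graph with respect to a symmetric set `B`, with edges `g → g * x` labeled by
`x ∈ B`. -/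
def cayleyGraph {G : Type*} [Group G] (B : Finset G) : LabeledGraph G B where
  edges := {e | e.1 * (e.2.1 : G) = e.2.2}

/-- A `B`-labeled graph `Γ` on a finite vertex set and a subset `U` of its vertices form an
`(r, ε)`-approximation of the group relative to `B`. -/
def IsSoficApproximation {G : Type*} [Group G] (B : Finset G) (r : ℕ) (ε : ℝ)
    {V : Type*} [Fintype V] (Γ : LabeledGraph V B) (U : Finset V) : Prop :=
  (∀ u ∈ U, Γ.BallIso u (cayleyGraph B) 1 r) ∧
    (1 - ε) * (Fintype.card V : ℝ) < (U.card : ℝ)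

/-- A group is sofic if it has a finite symmetric set of generators relative to which it has an
`(r, ε)`-approximation for all `r ≥ 0` and `ε > 0`. -/
def IsSofic (G : Type*) [Group G] : Prop :=
  ∃ B : Finset G, (∀ x ∈ B, x⁻¹ ∈ B) ∧ Subgroup.closure (B : Set G) = ⊤ ∧
    ∀ (r : ℕ) (ε : ℝ), 0 < ε →
      ∃ (V : Type) (_ : Fintype V) (Γ : LabeledGraph V B) (U : Finset V),
        IsSoficApproximation B r ε Γ U

/-!
Two facts are combined: an injective cellular automaton on a surjunctive or sofic group is
surjective, and a bijective cellular automaton on any group is balanced.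

*Bijective implies balanced* (`CellularAutomaton.isBalanced_of_bijective`). By compactness of
`G → S` the inverse of the global map is again local, with some finite window `K`
(`exists_finset_of_injective`). Take a support `M` that also contains `E * K⁻¹`. Extend a preimage
of a pattern `p` on `E` by a constant outside `M`, apply the global map, replace `p` by another
pattern `p'` in the result, and apply the inverse map. Only cells in `E * K⁻¹ ⊆ M` change, so a
preimage of `p'` on `M` is obtained, and no information is lost (`card_localMap_fiber_le`). Hence
all patterns on `E` have equally many preimages on `M`, which determines the number; a smaller
support changes it by the expected power of `|S|` (`card_localMap_fiber_mono`).

*Surjunctive groups.* Only the universe of the alphabet has to be adjusted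
(`IsSurjunctive.surjective`).

*Sofic groups* (`IsSofic.surjective`, the Gromov–Weiss theorem). Following labeled paths in a good
approximation `V` of the Cayley graph gives a map `σ : V → G → V` that looks like a free right
action of `G` at most points (`IsSofic.exists_isPartialAction`). The local rule read along `σ` maps
colorings of `V` to colorings of `V`. Injectivity of the automaton lets the color of each interior
point be recovered from the image, so the image has almost `|S| ^ |V|` elements
(`IsPartialAction.card_pow_le_card_avoiding`). If the automaton were not surjective, then by
compactness some pattern on a finite set `K` would never occur, and the image would avoid it on a
positive proportion of disjoint translates of `K` (`IsPartialAction.exists_packing`), which makes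
the image exponentially smaller than `|S| ^ |V|` (`IsPartialAction.card_avoiding_mul_le`).
-/

namespace CellularAutomaton

section Basic

variable {G S : Type*} [Group G]

theorem globalMap_translate (A : CellularAutomaton G S) (g : G) (c : G → S) :
    A.globalMap (translate g c) = translate g (A.globalMap c) := by
  funext x
  simp only [globalMap, translate, mul_assoc]

/-! ### Compactness of the full shift -/

theorem continuous_globalMap [TopologicalSpace S] [DiscreteTopology S] [Finite S]
    (A : CellularAutomaton G S) : Continuous A.globalMap := by
  refine continuous_pi fun g => ?_
  exact continuous_of_discreteTopology.comp (continuous_pi fun n => continuous_apply (g * (n : G)))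

/-- A configuration without a preimage already differs from every image on one common finite
window. -/
theorem exists_finset_of_notMem_range [Finite S] (A : CellularAutomaton G S) {d : G → S}
    (hd : d ∉ Set.range A.globalMap) :
    ∃ K : Finset G, ∀ c, ∃ g ∈ K, A.globalMap c g ≠ d g := by
  let _ : TopologicalSpace S := ⊥
  have : DiscreteTopology S := ⟨rfl⟩
  obtain ⟨K, hK⟩ := (isCompact_univ (X := G → S)).elim_finite_subfamily_closed
    (fun g : G => {c | A.globalMap c g = d g})
    (fun g => isClosed_eq ((continuous_apply g).comp A.continuous_globalMap) continuous_const)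
    (by
      rw [Set.univ_inter, Set.eq_empty_iff_forall_notMem]
      intro c hc
      exact hd ⟨c, funext fun g => Set.mem_iInter.1 hc g⟩)
  refine ⟨K, fun c => ?_⟩
  by_contra! hc
  have : c ∈ Set.univ ∩ ⋂ g ∈ K, {c | A.globalMap c g = d g} := by simpa using hc
  simp [hK] at this

/-- The inverse of an injective cellular automaton, defined on its image, is local: the state at
the identity depends on the image in a finite window only. -/
theorem exists_finset_of_injective [Finite S] (A : CellularAutomaton G S)
    (hA : Function.Injective A.globalMap) :
    ∃ K : Finset G, ∀ c c' : G → S,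
      (∀ g ∈ K, A.globalMap c g = A.globalMap c' g) → c 1 = c' 1 := by
  let _ : TopologicalSpace S := ⊥
  have : DiscreteTopology S := ⟨rfl⟩
  have hs : IsCompact {x : (G → S) × (G → S) | x.1 1 ≠ x.2 1} := by
    have h : Continuous fun x : (G → S) × (G → S) => (x.1 1, x.2 1) := by fun_prop
    exact ((isClosed_discrete {y : S × S | y.1 ≠ y.2}).preimage h).isCompact
  obtain ⟨K, hK⟩ := hs.elim_finite_subfamily_closed
    (fun g : G => {x : (G → S) × (G → S) | A.globalMap x.1 g = A.globalMap x.2 g})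
    (fun g => isClosed_eq
      ((continuous_apply g).comp (A.continuous_globalMap.comp continuous_fst))
      ((continuous_apply g).comp (A.continuous_globalMap.comp continuous_snd)))
    (by
      rw [Set.eq_empty_iff_forall_notMem]
      rintro ⟨c, c'⟩ ⟨h1, h2⟩
      have : c = c' := hA (funext fun g => Set.mem_iInter.1 h2 g)
      exact h1 (by rw [this]))
  refine ⟨K, fun c c' hc => ?_⟩
  by_contra hne
  have : (c, c') ∈ {x : (G → S) × (G → S) | x.1 1 ≠ x.2 1} ∩
      ⋂ g ∈ K, {x : (G → S) × (G → S) | A.globalMap x.1 g = A.globalMap x.2 g} := by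
    exact ⟨hne, by simpa using hc⟩
  simp [hK] at this

/-! ### Reversible cellular automata are balanced -/

/-- The pattern on `E` that the local rule produces from a pattern on `M ⊇ E * nbhd`. -/
def localMap (A : CellularAutomaton G S) {E M : Finset G}
    (h : ∀ g ∈ E, ∀ n ∈ A.nbhd, g * n ∈ M) (q : M → S) : E → S :=
  fun g => A.rule fun n : A.nbhd => q ⟨(g : G) * n, h g g.2 n n.2⟩

theorem isPreimage_iff (A : CellularAutomaton G S) {E M : Finset G}
    (h : ∀ g ∈ E, ∀ n ∈ A.nbhd, g * n ∈ M) (p : E → S) (q : M → S) :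
    A.IsPreimage p q ↔ A.localMap h q = p :=
  ⟨fun ⟨_, hq⟩ => funext fun g => (hq g).symm, fun hq => ⟨h, fun g => (congrFun hq g).symm⟩⟩

theorem localMap_restrict (A : CellularAutomaton G S) {E M : Finset G}
    (h : ∀ g ∈ E, ∀ n ∈ A.nbhd, g * n ∈ M) (c : G → S) :
    A.localMap h (fun x => c x) = fun g : E => A.globalMap c g := rfl

/-- Enlarging the support multiplies the number of preimages by the number of patterns on the
added cells. -/
theorem card_localMap_fiber_mono [Finite S] (A : CellularAutomaton G S) {E M M' : Finset G}
    (h : ∀ g ∈ E, ∀ n ∈ A.nbhd, g * n ∈ M) (hM : M ⊆ M') (p : E → S) :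
    Nat.card {q : M' → S // A.localMap (fun g hg n hn => hM (h g hg n hn)) q = p} =
      Nat.card {q : M → S // A.localMap h q = p} * Nat.card S ^ (M'.card - M.card) := by
  classical
  have e : {q : M' → S // A.localMap (fun g hg n hn => hM (h g hg n hn)) q = p} ≃
      {q : M → S // A.localMap h q = p} × ((M' \ M : Finset G) → S) :=
    { toFun := fun q => ⟨⟨fun x => q.1 ⟨x, hM x.2⟩, q.2⟩,
        fun x => q.1 ⟨x, (Finset.mem_sdiff.1 x.2).1⟩⟩
      invFun := fun q => ⟨fun x => if hx : (x : G) ∈ M then q.1.1 ⟨x, hx⟩ else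
        q.2 ⟨x, Finset.mem_sdiff.2 ⟨x.2, hx⟩⟩, by
          refine Eq.trans (funext fun g => ?_) q.1.2
          simp only [localMap]
          congr 1
          funext n
          exact dif_pos (h g g.2 n n.2)⟩
      left_inv := fun q => by
        ext x
        by_cases hx : (x : G) ∈ M <;> simp [hx]
      right_inv := fun q => by
        refine Prod.ext (Subtype.ext (funext fun x => ?_)) (funext fun x => ?_)
        · simp
        · exact dif_neg (Finset.mem_sdiff.1 x.2).2 }
  rw [Nat.card_congr e, Nat.card_prod, Nat.card_fun, Nat.card_eq_finsetCard,
    Finset.card_sdiff_of_subset hM]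

/-- On a support that contains all cells where the inverse can see `E`, any two patterns on `E`
have equally many preimages: exchanging them in the image and applying the inverse map
transforms the preimages of one injectively into the preimages of the other. -/
theorem card_localMap_fiber_le [Finite S] (A : CellularAutomaton G S)
    (hA : Function.Bijective A.globalMap) {E M K : Finset G}
    (hK : ∀ c c' : G → S, (∀ g ∈ K, A.globalMap c g = A.globalMap c' g) → c 1 = c' 1)
    (h : ∀ g ∈ E, ∀ n ∈ A.nbhd, g * n ∈ M) (hM : ∀ g ∈ E, ∀ k ∈ K, g * k⁻¹ ∈ M)
    (s₀ : S) (p p' : E → S) :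
    Nat.card {q : M → S // A.localMap h q = p} ≤ Nat.card {q : M → S // A.localMap h q = p'} := by
  classical
  let F : (G → S) ≃ (G → S) := Equiv.ofBijective _ hA
  let ext (q : M → S) : G → S := fun x => if hx : x ∈ M then q ⟨x, hx⟩ else s₀
  let swap (p : E → S) (d : G → S) : G → S := fun x => if hx : x ∈ E then p ⟨x, hx⟩ else d x
  let pull (p : E → S) (q : M → S) : G → S := F.symm (swap p (F (ext q)))
  have hext (q : M → S) : (fun x : M => ext q x) = q := by
    funext x
    simp [ext]
  have hF (p : E → S) (q : M → S) : A.globalMap (pull p q) = swap p (F (ext q)) :=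
    F.apply_symm_apply _
  -- The inverse map at `x` looks at `x * K`, which is disjoint from `E` for `x` outside `M`.
  have houtside (p : E → S) (q : M → S) (x : G) (hx : x ∉ M) : pull p q x = s₀ := by
    have h1 : translate x (pull p q) 1 = translate x (ext q) 1 := by
      refine hK _ _ fun k hk => ?_
      rw [globalMap_translate, globalMap_translate, hF]
      have hxk : x * k ∉ E := fun hE => hx (by simpa using hM _ hE k hk)
      simp only [translate, swap, dif_neg hxk]
      rfl
    simpa [translate, ext, hx] using h1
  have hmaps (q : M → S) : A.localMap h (fun x => pull p' q x) = p' := by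
    rw [localMap_restrict, hF]
    funext g
    simp [swap]
  refine Nat.card_le_card_of_injective
    (fun q => ⟨fun x => pull p' q.1 x, hmaps q.1⟩) fun q₁ q₂ hq => ?_
  have hpull : pull p' q₁.1 = pull p' q₂.1 := by
    funext x
    by_cases hx : x ∈ M
    · exact congrFun (Subtype.ext_iff.1 hq) ⟨x, hx⟩
    · rw [houtside _ _ _ hx, houtside _ _ _ hx]
  have hswap : swap p' (F (ext q₁.1)) = swap p' (F (ext q₂.1)) := F.symm.injective hpull
  have himage : F (ext q₁.1) = F (ext q₂.1) := by
    funext x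
    by_cases hx : x ∈ E
    · have (q : {q : M → S // A.localMap h q = p}) : F (ext q.1) x = p ⟨x, hx⟩ := by
        refine Eq.trans ?_ (congrFun q.2 ⟨x, hx⟩)
        conv_rhs => rw [← hext q.1]
        rfl
      rw [this, this]
    · simpa [swap, hx] using congrFun hswap x
  refine Subtype.ext ?_
  rw [← hext q₁.1, ← hext q₂.1, F.injective himage]

theorem isBalanced_of_bijective [Finite S] [Nonempty S] (A : CellularAutomaton G S)
    (hA : Function.Bijective A.globalMap) : A.IsBalanced := by
  classical
  intro E M h p
  obtain ⟨K, hK⟩ := A.exists_finset_of_injective hA.1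
  let M' : Finset G := M ∪ (E ×ˢ K).image fun x => x.1 * x.2⁻¹
  have hMM' : M ⊆ M' := Finset.subset_union_left
  have hM' : ∀ g ∈ E, ∀ k ∈ K, g * k⁻¹ ∈ M' := fun g hg k hk =>
    Finset.mem_union_right _ (Finset.mem_image.2 ⟨(g, k), Finset.mk_mem_product hg hk, rfl⟩)
  have h' : ∀ g ∈ E, ∀ n ∈ A.nbhd, g * n ∈ M' := fun g hg n hn => hMM' (h g hg n hn)
  obtain ⟨s₀⟩ := ‹Nonempty S›
  have := Fintype.ofFinite S
  have hconst (p' : E → S) : Nat.card {q : M' → S // A.localMap h' q = p'} =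
      Nat.card {q : M' → S // A.localMap h' q = p} :=
    le_antisymm (A.card_localMap_fiber_le hA hK h' hM' s₀ _ _)
      (A.card_localMap_fiber_le hA hK h' hM' s₀ _ _)
  have htotal : Nat.card S ^ M'.card =
      Nat.card S ^ E.card * Nat.card {q : M' → S // A.localMap h' q = p} := by
    have := Nat.card_congr (Equiv.sigmaFiberEquiv (A.localMap h'))
    rw [Nat.card_sigma, Finset.sum_congr rfl fun p' _ => hconst p'] at this
    simpa using this.symm
  rw [A.card_localMap_fiber_mono h hMM' p] at htotal
  have hpre : Nat.card {q : M → S // A.IsPreimage p q} =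
      Nat.card {q : M → S // A.localMap h q = p} :=
    Nat.card_congr (Equiv.subtypeEquivRight fun q => A.isPreimage_iff h p q)
  have hS : Nat.card S ≠ 0 := Nat.card_ne_zero.2 ⟨⟨s₀⟩, inferInstance⟩
  have hSQ : (Nat.card S : ℚ) ≠ 0 := Nat.cast_ne_zero.2 hS
  have hcard : Nat.card S ^ M.card =
      Nat.card S ^ E.card * Nat.card {q : M → S // A.localMap h q = p} := by
    refine Nat.eq_of_mul_eq_mul_right (pow_pos (Nat.pos_of_ne_zero hS) (M'.card - M.card)) ?_
    rw [← pow_add, Nat.add_sub_cancel' (Finset.card_le_card hMM'), htotal, mul_assoc]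
  rw [hpre, zpow_sub₀ hSQ, eq_div_iff (zpow_ne_zero _ hSQ), zpow_natCast, zpow_natCast, mul_comm]
  exact_mod_cast hcard.symm

/-! ### Change of alphabet -/

/-- The cellular automaton with its states renamed along a bijection. -/
def mapStates {T : Type*} (A : CellularAutomaton G S) (e : S ≃ T) : CellularAutomaton G T where
  nbhd := A.nbhd
  rule := fun q => e (A.rule fun n => e.symm (q n))

theorem globalMap_mapStates {T : Type*} (A : CellularAutomaton G S) (e : S ≃ T) :
    (A.mapStates e).globalMap =
      (Equiv.arrowCongr (Equiv.refl G) e) ∘ A.globalMap ∘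
        (Equiv.arrowCongr (Equiv.refl G) e).symm := rfl

end Basic

end CellularAutomaton

/-- Surjunctivity, which only mentions alphabets in `Type`, applies to alphabets in every
universe. -/
theorem IsSurjunctive.surjective {G S : Type*} [Group G] [Finite S] [Nontrivial S]
    (hG : IsSurjunctive G) (A : CellularAutomaton G S) (hA : Function.Injective A.globalMap) :
    Function.Surjective A.globalMap := by
  obtain ⟨n, ⟨e⟩⟩ := Finite.exists_equiv_fin S
  have : Nontrivial (Fin n) := e.symm.nontrivial
  have h := hG (Fin n) (A.mapStates e)
  rw [CellularAutomaton.globalMap_mapStates] at h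
  simpa using h (by simpa using hA)

/-! ### Labeled paths -/

namespace LabeledGraph

variable {V L : Type*}

/-- There is a path from `u` to `v` whose consecutive labels spell the word `w`. -/
def IsPath (Γ : LabeledGraph V L) : List L → V → V → Prop
  | [], u, v => u = v
  | l :: w, u, v => ∃ x, (u, l, x) ∈ Γ.edges ∧ Γ.IsPath w x v

variable {Γ : LabeledGraph V L}

theorem IsPath.append {w w' : List L} {u v x : V} (h : Γ.IsPath w u v) (h' : Γ.IsPath w' v x) :
    Γ.IsPath (w ++ w') u x := by
  induction w generalizing u with
  | nil =>
    obtain rfl : u = v := h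
    exact h'
  | cons l w ih =>
    obtain ⟨y, hy, hw⟩ := h
    exact ⟨y, hy, ih hw⟩

theorem exists_isPath_of_append {w w' : List L} {u x : V} (h : Γ.IsPath (w ++ w') u x) :
    ∃ v, Γ.IsPath w u v ∧ Γ.IsPath w' v x := by
  induction w generalizing u with
  | nil => exact ⟨u, rfl, h⟩
  | cons l w ih =>
    obtain ⟨y, hy, hw⟩ := h
    obtain ⟨v, hv, hv'⟩ := ih hw
    exact ⟨v, ⟨y, hy, hv⟩, hv'⟩

theorem ball_mono (Γ : LabeledGraph V L) (u : V) : Monotone (Γ.ball u) :=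
  monotone_nat_of_le_succ fun _ => Set.subset_union_left

theorem mem_ball_succ_of_edge {u x y : V} {l : L} {k : ℕ} (hx : x ∈ Γ.ball u k)
    (h : (x, l, y) ∈ Γ.edges) : y ∈ Γ.ball u (k + 1) :=
  Or.inr ⟨x, hx, l, h⟩

end LabeledGraph

section Sofic

variable {G : Type*} [Group G]

/-- The group element spelled by a word in the generators. -/
def wordProd {B : Finset G} (w : List B) : G := (w.map Subtype.val).prod

@[simp]
theorem wordProd_append {B : Finset G} (w w' : List B) :
    wordProd (w ++ w') = wordProd w * wordProd w' := by
  simp [wordProd]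

theorem exists_wordProd_eq {B : Finset G} (hB : ∀ x ∈ B, x⁻¹ ∈ B)
    (hgen : Subgroup.closure (B : Set G) = ⊤) (g : G) : ∃ w : List B, wordProd w = g := by
  have hg : g ∈ (Subgroup.closure (B : Set G)).toSubmonoid := by simp [hgen]
  rw [Subgroup.closure_toSubmonoid] at hg
  obtain ⟨l, hl, rfl⟩ := Submonoid.exists_list_of_mem_closure hg
  have hl' : ∀ x ∈ l, x ∈ B := fun x hx =>
    (hl x hx).elim id fun h => by simpa using hB _ (Finset.mem_coe.1 h)
  lift l to List B using hl'
  exact ⟨l, rfl⟩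

/-- Up to length `r`, paths of `Γ` that start at `u` behave as in the Cayley graph: every word is
the label of a path, and two paths have the same endpoint exactly if their words spell the same
group element. -/
structure HasCayleyPaths {B : Finset G} {V : Type*} (Γ : LabeledGraph V B) (u : V) (r : ℕ) :
    Prop where
  exists_isPath : ∀ w : List B, w.length ≤ r → ∃ v, Γ.IsPath w u v
  eq_iff : ∀ {w w' : List B} {v v' : V}, w.length ≤ r → w'.length ≤ r →
    Γ.IsPath w u v → Γ.IsPath w' u v' → (v = v' ↔ wordProd w = wordProd w')

theorem LabeledGraph.BallIso.hasCayleyPaths {B : Finset G} {V : Type*} {Γ : LabeledGraph V B}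
    {u : V} {r : ℕ} (h : Γ.BallIso u (cayleyGraph B) 1 r) : HasCayleyPaths Γ u r := by
  obtain ⟨φ, hφ, hu⟩ := h
  have hmem {k : ℕ} (hk : k ≤ r) {x : V} (hx : x ∈ Γ.ball u k) : x ∈ Γ.ball u r :=
    Γ.ball_mono u hk hx
  have hcenter : u ∈ Γ.ball u 0 := rfl
  have hone : (φ ⟨u, hmem (Nat.zero_le r) hcenter⟩ : G) = 1 := hu _ rfl
  have hpath (w : List B) : ∀ (k : ℕ) (x v : V) (hx : x ∈ Γ.ball u r), x ∈ Γ.ball u k →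
      k + w.length ≤ r → Γ.IsPath w x v →
      ∃ hv : v ∈ Γ.ball u r, (φ ⟨v, hv⟩ : G) = φ ⟨x, hx⟩ * wordProd w := by
    induction w with
    | nil =>
      rintro k x v hx - - rfl
      exact ⟨hx, by simp [wordProd]⟩
    | cons l w ih =>
      rintro k x v hx hxk hk ⟨y, hxy, hw⟩
      rw [List.length_cons] at hk
      have hyk := LabeledGraph.mem_ball_succ_of_edge hxk hxy
      have hy := hmem (by omega) hyk
      obtain ⟨hv, hφv⟩ := ih (k + 1) y v hy hyk (by omega) hw
      have hedge : (φ ⟨x, hx⟩ : G) * l = φ ⟨y, hy⟩ := (hφ ⟨x, hx⟩ ⟨y, hy⟩ l).1 hxy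
      exact ⟨hv, by rw [hφv, ← hedge]; simp [wordProd, mul_assoc]⟩
  have hex (w : List B) : ∀ (k : ℕ) (x : V) (hx : x ∈ Γ.ball u r), x ∈ Γ.ball u k →
      (φ ⟨x, hx⟩ : G) ∈ (cayleyGraph B).ball 1 k → k + w.length ≤ r → ∃ v, Γ.IsPath w x v := by
    induction w with
    | nil => exact fun k x _ _ _ _ => ⟨x, rfl⟩
    | cons l w ih =>
      intro k x hx hxk hφx hk
      rw [List.length_cons] at hk
      have hyk : (φ ⟨x, hx⟩ : G) * l ∈ (cayleyGraph B).ball 1 (k + 1) :=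
        LabeledGraph.mem_ball_succ_of_edge (l := l) hφx rfl
      obtain ⟨⟨y, hy⟩, hφy⟩ := φ.surjective ⟨_, (cayleyGraph B).ball_mono 1 (by omega) hyk⟩
      have hxy : (x, l, y) ∈ Γ.edges :=
        (hφ ⟨x, hx⟩ ⟨y, hy⟩ l).2 (congrArg Subtype.val hφy).symm
      obtain ⟨v, hv⟩ := ih (k + 1) y hy (LabeledGraph.mem_ball_succ_of_edge hxk hxy)
        (by rw [hφy]; exact hyk) (by omega)
      exact ⟨v, y, hxy, hv⟩
  refine ⟨fun w hw => hex w 0 u (hmem (Nat.zero_le r) hcenter) hcenter hone (by omega),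
    fun {w w' v v'} hw hw' h h' => ?_⟩
  obtain ⟨hv, hφv⟩ := hpath w 0 u v (hmem (Nat.zero_le r) hcenter) hcenter (by omega) h
  obtain ⟨hv', hφv'⟩ := hpath w' 0 u v' (hmem (Nat.zero_le r) hcenter) hcenter (by omega) h'
  rw [hone, one_mul] at hφv hφv'
  rw [← hφv, ← hφv', Subtype.val_inj, φ.injective.eq_iff, Subtype.mk.injEq]

/-- A vertex is determined by the label and the endpoint of a short path that starts there. The
endpoint itself need not satisfy `HasCayleyPaths`: the inverse path is found inside the
neighborhood of the starting vertex. -/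
theorem HasCayleyPaths.eq_of_isPath {B : Finset G} (hB : ∀ x ∈ B, x⁻¹ ∈ B) {V : Type*}
    {Γ : LabeledGraph V B} {u u' v : V} {r : ℕ} (hu : HasCayleyPaths Γ u (2 * r))
    (hu' : HasCayleyPaths Γ u' (2 * r)) {w : List B} (hw : w.length ≤ r)
    (h : Γ.IsPath w u v) (h' : Γ.IsPath w u' v) : u = u' := by
  let w' : List B := (w.map fun b => ⟨(b : G)⁻¹, hB b b.2⟩).reverse
  have hw' : w'.length = w.length := by simp [w']
  have hprod : wordProd (w ++ w') = 1 := by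
    rw [wordProd_append, mul_eq_one_iff_inv_eq]
    simp [wordProd, w', List.prod_inv_reverse, List.map_reverse, Function.comp_def]
  have hlen : (w ++ w').length ≤ 2 * r := by rw [List.length_append]; omega
  have hback {x : V} (hx : HasCayleyPaths Γ x (2 * r)) (hxv : Γ.IsPath w x v) :
      Γ.IsPath w' v x := by
    obtain ⟨z, hz⟩ := hx.exists_isPath _ hlen
    obtain ⟨y, hy, hyz⟩ := LabeledGraph.exists_isPath_of_append hz
    obtain rfl : y = v := (hx.eq_iff (by omega) (by omega) hy hxv).2 rfl
    obtain rfl : z = x := (hx.eq_iff hlen (w' := []) (by simp) hz rfl).2 (by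
      rw [hprod]; simp [wordProd])
    exact hyz
  exact ((hu.eq_iff hlen (w' := []) (by simp) (h.append (hback hu' h')) rfl).2
    (by rw [hprod]; simp [wordProd])).symm

/-! ### Sofic groups act approximately on finite sets -/

/-- The map `σ` behaves like a free right action of the group on the points of `U`, as far as
elements of `K` can tell; `σ u g` is the point reached from `u` by moving along `g`. -/
structure IsPartialAction {V : Type*} (K : Finset G) (U : Finset V) (σ : V → G → V) : Prop where
  apply_one : ∀ u ∈ U, σ u 1 = u
  apply_mul : ∀ u ∈ U, ∀ g ∈ K, ∀ h ∈ K, σ u g ∈ U → σ (σ u g) h = σ u (g * h)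
  injOn_group : ∀ u ∈ U, Set.InjOn (σ u) K
  injOn_points : ∀ g ∈ K, Set.InjOn (fun u => σ u g) U

theorem IsSofic.exists_isPartialAction (hG : IsSofic G) (K : Finset G) (D : ℕ) :
    ∃ (V : Type) (_ : Fintype V) (U : Finset V) (σ : V → G → V),
      IsPartialAction K U σ ∧ D * (Fintype.card V - U.card) < Fintype.card V := by
  classical
  obtain ⟨B, hB, hgen, happrox⟩ := hG
  choose wd hwd using exists_wordProd_eq hB hgen
  let K' : Finset G := {1} ∪ K ∪ (K ×ˢ K).image fun x => x.1 * x.2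
  let r := K'.sup fun g => (wd g).length
  have hr {g : G} (hg : g ∈ K') : (wd g).length ≤ r :=
    Finset.le_sup (f := fun g => (wd g).length) hg
  have hr1 : (wd 1).length ≤ r := hr (by simp [K'])
  have hrK {g : G} (hg : g ∈ K) : (wd g).length ≤ r := hr (by simp [K', hg])
  have hrKK {g h : G} (hg : g ∈ K) (hh : h ∈ K) : (wd (g * h)).length ≤ r :=
    hr (Finset.mem_union_right _ (Finset.mem_image.2 ⟨(g, h), Finset.mk_mem_product hg hh, rfl⟩))
  obtain ⟨V, _, Γ, U, hU, hcard⟩ := happrox (2 * r) (1 / (D + 1)) (by positivity)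
  have hUp (u : V) (hu : u ∈ U) : HasCayleyPaths Γ u (2 * r) := (hU u hu).hasCayleyPaths
  have hσ (u : V) (g : G) : ∃ v, u ∈ U → (wd g).length ≤ r → Γ.IsPath (wd g) u v := by
    by_cases h : u ∈ U ∧ (wd g).length ≤ r
    · obtain ⟨v, hv⟩ := (hUp u h.1).exists_isPath (wd g) (by omega)
      exact ⟨v, fun _ _ => hv⟩
    · exact ⟨u, fun h1 h2 => absurd ⟨h1, h2⟩ h⟩
  choose σ hσ using hσ
  refine ⟨V, inferInstance, U, σ, ⟨fun u hu => ?_, fun u hu g hg h hh hug => ?_,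
    fun u hu g hg h hh hgh => ?_, fun g hg u hu u' hu' huu' => ?_⟩, ?_⟩
  · exact ((hUp u hu).eq_iff (w' := []) (by omega) (by simp) (hσ u 1 hu hr1) rfl).2
      (by rw [hwd]; simp [wordProd])
  · have h1 := (hσ u g hu (hrK hg)).append (hσ (σ u g) h hug (hrK hh))
    have h2 := hσ u (g * h) hu (hrKK hg hh)
    have := hrK hg
    have := hrK hh
    have := hrKK hg hh
    exact ((hUp u hu).eq_iff (by rw [List.length_append]; omega) (by omega) h1 h2).2
      (by rw [wordProd_append, hwd, hwd, hwd])
  · have := hrK hg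
    have := hrK hh
    have := ((hUp u hu).eq_iff (by omega) (by omega) (hσ u g hu (hrK hg))
      (hσ u h hu (hrK hh))).1 hgh
    rwa [hwd, hwd] at this
  · refine (hUp u hu).eq_of_isPath hB (hUp u' hu') (hrK hg) (hσ u g hu (hrK hg)) ?_
    have huu : σ u g = σ u' g := huu'
    rw [huu]
    exact hσ u' g hu' (hrK hg)
  · have hUV : U.card ≤ Fintype.card V := Finset.card_le_univ U
    have hD : ((D : ℝ) + 1) * ((Fintype.card V : ℝ) - U.card) < Fintype.card V := by
      have hpos : (0 : ℝ) < D + 1 := by positivity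
      have h := mul_lt_mul_of_pos_left hcard hpos
      have h1 : ((D : ℝ) + 1) * ((1 - 1 / (D + 1)) * Fintype.card V) =
          ((D : ℝ) + 1) * Fintype.card V - Fintype.card V := by
        field_simp
      rw [h1] at h
      linarith
    have hD' : (D + 1) * (Fintype.card V - U.card) < Fintype.card V := by
      rw [← Nat.cast_sub hUV] at hD
      exact_mod_cast hD
    exact lt_of_le_of_lt (Nat.mul_le_mul_right _ (Nat.le_succ D)) hD'

end Sofic

/-! ### Packing and counting -/

section Counting

variable {G : Type*} [Group G] {V : Type*} [Fintype V] [DecidableEq V] {K : Finset G}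
  {U : Finset V} {σ : V → G → V}

/-- The points of `U` that no element of `K` moves out of `U`. -/
def partialInterior (K : Finset G) (U : Finset V) (σ : V → G → V) : Finset V :=
  U.filter fun u => ∀ k ∈ K, σ u k ∈ U

theorem IsPartialAction.card_le_card_partialInterior_add (hσ : IsPartialAction K U σ) :
    Fintype.card V ≤
      (partialInterior K U σ).card + (K.card + 1) * (Fintype.card V - U.card) := by
  have hsub : (Finset.univ : Finset V) ⊆ partialInterior K U σ ∪
      (Uᶜ ∪ K.biUnion fun k => U.filter fun u => σ u k ∉ U) := by
    intro u _
    by_cases hu : u ∈ U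
    · by_cases h : ∀ k ∈ K, σ u k ∈ U
      · exact Finset.mem_union_left _ (Finset.mem_filter.2 ⟨hu, h⟩)
      · push Not at h
        obtain ⟨k, hk, hk'⟩ := h
        refine Finset.mem_union_right _ (Finset.mem_union_right _ ?_)
        exact Finset.mem_biUnion.2 ⟨k, hk, Finset.mem_filter.2 ⟨hu, hk'⟩⟩
    · exact Finset.mem_union_right _ (Finset.mem_union_left _ (Finset.mem_compl.2 hu))
  have hexit : (K.biUnion fun k => U.filter fun u => σ u k ∉ U).card ≤ K.card * Uᶜ.card := by
    refine Finset.card_biUnion_le_card_mul _ _ _ fun k hk => ?_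
    refine Finset.card_le_card_of_injOn (fun u => σ u k) (fun u hu => ?_) ?_
    · simpa using (Finset.mem_filter.1 hu).2
    · exact (hσ.injOn_points k hk).mono fun u hu => (Finset.mem_filter.1 hu).1
  calc Fintype.card V ≤ _ := Finset.card_le_card hsub
    _ ≤ _ := (Finset.card_union_le _ _).trans
      (Nat.add_le_add_left ((Finset.card_union_le _ _).trans (Nat.add_le_add_left hexit _)) _)
    _ = _ := by rw [Finset.card_compl]; ring

/-- A maximal family of points with disjoint translates of `K` contains a fraction of at least
`1 / |K| ^ 2` of the points. -/
theorem IsPartialAction.exists_packing (hσ : IsPartialAction K U σ) (h1 : 1 ∈ K) {U' : Finset V}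
    (hU' : U' ⊆ U) :
    ∃ W ⊆ U', (∀ w ∈ W, ∀ w' ∈ W, ∀ k ∈ K, ∀ k' ∈ K, σ w k = σ w' k' → w = w') ∧
      U'.card ≤ W.card * K.card ^ 2 := by
  classical
  let P (W : Finset V) : Prop :=
    ∀ w ∈ W, ∀ w' ∈ W, ∀ k ∈ K, ∀ k' ∈ K, σ w k = σ w' k' → w = w'
  obtain ⟨W, hW, hmax⟩ := (U'.powerset.filter P).exists_max_image Finset.card
    ⟨∅, by simp [P]⟩
  rw [Finset.mem_filter, Finset.mem_powerset] at hW
  refine ⟨W, hW.1, hW.2, ?_⟩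
  have hmeet (u : V) (hu : u ∈ U') : ∃ x : V × G × G,
      x ∈ W ×ˢ K ×ˢ K ∧ σ u x.2.1 = σ x.1 x.2.2 := by
    by_cases huW : u ∈ W
    · exact ⟨(u, 1, 1), by simp [huW, h1], rfl⟩
    by_contra! hne
    have hP : P (insert u W) := by
      intro w hw w' hw' k hk k' hk' hkk
      rcases Finset.mem_insert.1 hw with rfl | hwW <;>
        rcases Finset.mem_insert.1 hw' with rfl | hwW'
      · rfl
      · exact absurd hkk (hne (w', k, k') (by simp [hwW', hk, hk']))
      · exact absurd hkk.symm (hne (w, k', k) (by simp [hwW, hk, hk']))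
      · exact hW.2 w hwW w' hwW' k hk k' hk' hkk
    have := hmax (insert u W) (Finset.mem_filter.2
      ⟨Finset.mem_powerset.2 (Finset.insert_subset hu hW.1), hP⟩)
    rw [Finset.card_insert_of_notMem huW] at this
    omega
  rcases isEmpty_or_nonempty V with hV | hV
  · simp [Finset.eq_empty_of_isEmpty U']
  choose! τ hτ hτ' using hmeet
  have hcard : U'.card ≤ (W ×ˢ K ×ˢ K).card := by
    refine Finset.card_le_card_of_injOn τ hτ fun u hu u' hu' h => ?_
    refine hσ.injOn_points (τ u).2.1 ?_ (hU' hu) (hU' hu') ?_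
    · exact (Finset.mem_product.1 (Finset.mem_product.1 (hτ u hu)).2).1
    · have h2 := hτ' u' hu'
      rw [← h] at h2
      exact (hτ' u hu).trans h2.symm
  rwa [Finset.card_product, Finset.card_product, ← sq] at hcard

/-- Each of the disjoint translates of `K` on which the pattern `p` is forbidden costs a factor
of `(|S| ^ |K| - 1) / |S| ^ |K|` in the number of colorings. -/
theorem IsPartialAction.card_avoiding_mul_le {S : Type*} [Finite S] (hσ : IsPartialAction K U σ)
    {W : Finset V} (hWU : W ⊆ U)
    (hW : ∀ w ∈ W, ∀ w' ∈ W, ∀ k ∈ K, ∀ k' ∈ K, σ w k = σ w' k' → w = w') (p : K → S) :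
    Nat.card {c : V → S // ∀ w ∈ W, (fun k : K => c (σ w k)) ≠ p} *
        (Nat.card S ^ K.card) ^ W.card ≤
      (Nat.card S ^ K.card - 1) ^ W.card * Nat.card S ^ Fintype.card V := by
  classical
  have := Fintype.ofFinite S
  let Z : Finset V := W.biUnion fun w => K.image (σ w)
  have hZ : Z.card = W.card * K.card := by
    refine (Finset.card_biUnion fun w hw w' hw' hne => ?_).trans ?_
    · refine Finset.disjoint_left.2 fun v hv hv' => hne ?_
      obtain ⟨k, hk, rfl⟩ := Finset.mem_image.1 hv
      obtain ⟨k', hk', h⟩ := Finset.mem_image.1 hv'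
      exact hW w hw w' hw' k hk k' hk' h.symm
    · exact Finset.sum_const_nat fun w hw =>
        Finset.card_image_of_injOn (hσ.injOn_group w (hWU hw))
  have hZV : W.card * K.card + Zᶜ.card = Fintype.card V := by
    rw [← hZ, Finset.card_add_card_compl]
  let f (c : {c : V → S // ∀ w ∈ W, (fun k : K => c (σ w k)) ≠ p}) :
      (W → {q : K → S // q ≠ p}) × ((Zᶜ : Finset V) → S) :=
    (fun w => ⟨fun k => c.1 (σ w k), c.2 w w.2⟩, fun v => c.1 v)
  have hf : Function.Injective f := by
    intro c c' h
    refine Subtype.ext (funext fun v => ?_)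
    by_cases hv : v ∈ Z
    · obtain ⟨w, hw, hv⟩ := Finset.mem_biUnion.1 hv
      obtain ⟨k, hk, rfl⟩ := Finset.mem_image.1 hv
      exact congrFun (Subtype.ext_iff.1 (congrFun (congrArg Prod.fst h) ⟨w, hw⟩)) ⟨k, hk⟩
    · exact congrFun (congrArg Prod.snd h) ⟨v, Finset.mem_compl.2 hv⟩
  have hcard := Nat.card_le_card_of_injective f hf
  have hne : Nat.card {q : K → S // q ≠ p} = Nat.card S ^ K.card - 1 := by
    rw [Nat.card_eq_fintype_card, Fintype.card_subtype_compl]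
    simp
  rw [Nat.card_prod, Nat.card_fun, Nat.card_fun, hne, Nat.card_eq_finsetCard,
    Nat.card_eq_finsetCard] at hcard
  calc _ ≤ (Nat.card S ^ K.card - 1) ^ W.card * Nat.card S ^ Zᶜ.card *
        (Nat.card S ^ K.card) ^ W.card := Nat.mul_le_mul_right _ hcard
    _ = _ := by rw [← hZV, pow_add, pow_mul', mul_assoc, mul_comm (Nat.card S ^ Zᶜ.card)]

/-- The update rule, read along `σ`, turns a coloring of `V` into another one. At interior points
the images avoid every pattern that is missing from the image of the global map, and they
determine the original coloring. -/
theorem IsPartialAction.card_pow_le_card_avoiding {S : Type*} [Finite S] [Nonempty S]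
    (hσ : IsPartialAction K U σ) (A : CellularAutomaton G S) (hN : A.nbhd ⊆ K)
    (hinj : ∀ c c' : G → S, (∀ g ∈ K, A.globalMap c g = A.globalMap c' g) → c 1 = c' 1)
    {d : G → S} (hd : ∀ c, ∃ g ∈ K, A.globalMap c g ≠ d g)
    {W : Finset V} (hW : W ⊆ partialInterior K U σ) :
    Nat.card S ^ (partialInterior K U σ).card ≤
      Nat.card {c : V → S // ∀ w ∈ W, (fun k : K => c (σ w k)) ≠ fun k : K => d k} := by
  classical
  let Φ (c : V → S) : V → S := fun v => A.rule fun n : A.nbhd => c (σ v n)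
  -- `g ↦ c (σ u g)` is the pullback of `c` to a configuration on the group, seen from `u`.
  have hpull (c : V → S) (u : V) (hu : u ∈ partialInterior K U σ) (k : G) (hk : k ∈ K) :
      A.globalMap (fun g => c (σ u g)) k = Φ c (σ u k) := by
    obtain ⟨huU, hint⟩ := Finset.mem_filter.1 hu
    simp only [CellularAutomaton.globalMap, CellularAutomaton.translate, Φ]
    congr 1
    funext n
    rw [hσ.apply_mul u huU k hk n (hN n.2) (hint k hk)]
  have havoid (c : V → S) : ∀ w ∈ W, (fun k : K => Φ c (σ w k)) ≠ fun k : K => d k := by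
    intro w hw h
    obtain ⟨g, hg, hne⟩ := hd fun g => c (σ w g)
    rw [hpull c w (hW hw) g hg] at hne
    exact hne (congrFun h ⟨g, hg⟩)
  have hdet (c c' : V → S) (h : Φ c = Φ c') (u : V) (hu : u ∈ partialInterior K U σ) :
      c u = c' u := by
    have := hinj (fun g => c (σ u g)) (fun g => c' (σ u g)) fun g hg => by
      rw [hpull c u hu g hg, hpull c' u hu g hg, h]
    simpa only [hσ.apply_one u (Finset.mem_filter.1 hu).1] using this
  obtain ⟨s₀⟩ := ‹Nonempty S›
  let ext (a : partialInterior K U σ → S) : V → S := fun v =>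
    if hv : v ∈ partialInterior K U σ then a ⟨v, hv⟩ else s₀
  have hcard := Nat.card_le_card_of_injective
    (fun a : partialInterior K U σ → S =>
      (⟨Φ (ext a), havoid _⟩ : {c : V → S // ∀ w ∈ W, (fun k : K => c (σ w k)) ≠ fun k : K => d k}))
    (fun a a' h => funext fun u => by
      have := hdet _ _ (Subtype.ext_iff.1 h) u u.2
      simpa [ext] using this)
  rwa [Nat.card_fun, Nat.card_eq_finsetCard] at hcard

end Counting

/-! ### Sofic groups are surjunctive -/

theorem exists_mul_pow_lt_pow {a b : ℕ} (hb : 0 < b) (hab : b < a) (s : ℕ) :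
    ∃ T : ℕ, s * b ^ T < a ^ T := by
  have hb' : (0 : ℝ) < b := by exact_mod_cast hb
  obtain ⟨T, hT⟩ := pow_unbounded_of_one_lt (s : ℝ)
    ((one_lt_div hb').2 (by exact_mod_cast hab : (b : ℝ) < a))
  refine ⟨T, ?_⟩
  rw [div_pow, lt_div_iff₀ (by positivity)] at hT
  exact_mod_cast hT

theorem mul_pow_lt_pow_of_mul_lt {a b s T j w : ℕ} (hab : b < a) (hT : s * b ^ T < a ^ T)
    (hw : T * j < w) : s ^ j * b ^ w < a ^ w := by
  obtain ⟨m, rfl⟩ := Nat.exists_eq_add_of_lt hw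
  have h1 : s ^ j * b ^ (T * j) ≤ a ^ (T * j) := by
    rw [pow_mul, pow_mul, ← mul_pow]
    exact Nat.pow_le_pow_left hT.le j
  have h2 : b ^ (m + 1) < a ^ (m + 1) := Nat.pow_lt_pow_left hab (Nat.succ_ne_zero m)
  have ha : 0 < a ^ (T * j) := pow_pos (by omega) _
  calc s ^ j * b ^ (T * j + m + 1) = s ^ j * b ^ (T * j) * b ^ (m + 1) := by ring
    _ ≤ a ^ (T * j) * b ^ (m + 1) := Nat.mul_le_mul_right _ h1
    _ < a ^ (T * j) * a ^ (m + 1) := Nat.mul_lt_mul_of_pos_left h2 ha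
    _ = a ^ (T * j + m + 1) := by ring

/-- The Gromov–Weiss theorem: an injective cellular automaton on a sofic group is surjective. -/
theorem IsSofic.surjective {G S : Type*} [Group G] [Finite S] [Nontrivial S] (hG : IsSofic G)
    (A : CellularAutomaton G S) (hA : Function.Injective A.globalMap) :
    Function.Surjective A.globalMap := by
  classical
  by_contra hsurj
  obtain ⟨d, hd⟩ := not_forall.1 hsurj
  obtain ⟨K₁, hK₁⟩ := A.exists_finset_of_notMem_range hd
  obtain ⟨K₂, hK₂⟩ := A.exists_finset_of_injective hA
  let K : Finset G := insert 1 (A.nbhd ∪ (K₁ ∪ K₂))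
  have h1 : 1 ∈ K := Finset.mem_insert_self _ _
  have hN : A.nbhd ⊆ K := fun g hg => by simp [K, hg]
  have hK₁K : ∀ c, ∃ g ∈ K, A.globalMap c g ≠ d g := fun c => by
    obtain ⟨g, hg, h⟩ := hK₁ c
    exact ⟨g, by simp [K, hg], h⟩
  have hK₂K : ∀ c c' : G → S, (∀ g ∈ K, A.globalMap c g = A.globalMap c' g) → c 1 = c' 1 :=
    fun c c' h => hK₂ c c' fun g hg => h g (by simp [K, hg])
  have hs : 1 < Nat.card S := Finite.one_lt_card
  have hK : K.card ≠ 0 := (Finset.card_pos.2 ⟨1, h1⟩).ne'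
  have ha : 1 < Nat.card S ^ K.card := Nat.one_lt_pow hK hs
  obtain ⟨T, hT⟩ := exists_mul_pow_lt_pow (a := Nat.card S ^ K.card)
    (b := Nat.card S ^ K.card - 1) (by omega) (by omega) (Nat.card S)
  -- The approximation is so good that the number of non-interior points, even multiplied by `T`,
  -- is smaller than the number of disjoint translates of `K` that fit in the interior.
  obtain ⟨V, _, U, σ, hσ, hcard⟩ :=
    hG.exists_isPartialAction K ((T * K.card ^ 2 + 1) * (K.card + 1))
  set U' := partialInterior K U σ with hU'
  have hUU' : U' ⊆ U := Finset.filter_subset _ _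
  obtain ⟨W, hWU', hW, hWcard⟩ := hσ.exists_packing h1 hUU'
  have hU'V : U'.card ≤ Fintype.card V := Finset.card_le_univ U'
  have hU'card := hσ.card_le_card_partialInterior_add
  rw [← hU'] at hU'card
  obtain ⟨j, hj⟩ := Nat.exists_eq_add_of_le hU'V
  have hjW : T * j < W.card := by
    have h2 : (T * K.card ^ 2 + 1) * j < U'.card + j := by
      rw [← hj]
      refine lt_of_le_of_lt ?_ hcard
      rw [mul_assoc]
      exact Nat.mul_le_mul_left _ (by omega)
    have h3 : T * j * K.card ^ 2 < W.card * K.card ^ 2 := by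
      refine lt_of_lt_of_le ?_ hWcard
      have : (T * K.card ^ 2 + 1) * j = T * j * K.card ^ 2 + j := by ring
      omega
    exact lt_of_mul_lt_mul_right h3 (Nat.zero_le _)
  have hlower := hσ.card_pow_le_card_avoiding A hN hK₂K hK₁K hWU'
  have hupper := hσ.card_avoiding_mul_le (hWU'.trans hUU') hW fun k : K => d k
  have hle := (Nat.mul_le_mul_right _ hlower).trans hupper
  rw [← hU', hj, pow_add, mul_left_comm] at hle
  have hle' := Nat.le_of_mul_le_mul_left hle (pow_pos (by omega) _)
  rw [mul_comm] at hle'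
  exact absurd (mul_pow_lt_pow_of_mul_lt (by omega) hT hjW) (not_lt.2 hle')

theorem mainTheorem7 {G S : Type*} [Group G] [Finite S] [Nontrivial S]
    (A : CellularAutomaton G S) (hA : Function.Injective A.globalMap) :
    (IsSurjunctive G → A.IsBalanced) ∧ (IsSofic G → A.IsBalanced) :=
  ⟨fun hG => A.isBalanced_of_bijective ⟨hA, hG.surjective A hA⟩,
    fun hG => A.isBalanced_of_bijective ⟨hA, hG.surjective A hA⟩⟩
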